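/- Let $\mathcal N$ be a von Neumann algebra acting on a complex Hilbert space $H$, with a fixed faithful, normal, semifinite trace $\tau$. Let $\mathcal K_{\mathcal N}$ be the norm-closed two-sided ideal of $\mathcal N$ generated by the projections of finite trace, and let $\pi:\mathcal N\to\mathcal N/\mathcal K_{\mathcal N}$ be the quotient map onto the generalised Calkin algebra, which carries the quotient norm. For a subspace $K\subseteq H$ write $[K]$ for the orthogonal projection onto the closure of $K$. For projections $P,Q\in\mathcal N$, an operator $T\in P\mathcal N Q$ is called $(P\cdot Q)$-$\tau$-Breuer–Fredholm if 1. the projections $[\ker(T)\cap Q(H)]$ and $[\ker(T^*)\cap P(H)]$ have finite trace, and 2. there is a projection $P_1\in\mathcal N$ with $P_1\le P$, $\tau(P-P_1)<\infty$ and $P_1(H)\subseteq T(H)$. Lemma 4.1. Let $P,Q$ be projections in $\mathcal N$. Then $PQ\in P\mathcal N Q$ is $(P\cdot Q)$-$\tau$-Breuer–Fredholm if and only if $\|\pi(P)-\pi(Q)\|<1$. -/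

import Mathlib

open scoped NNReal ENNReal

noncomputable section

namespace BreuerFredholm

variable {H : Type*} [NormedAddCommGroup H] [InnerProductSpace ℂ H] [CompleteSpace H]

/-- A von Neumann algebra is closed under multiplication by complex scalars, so that its
elements form a complex normed algebra with the operator norm. -/
instance instSMulMemClass : SMulMemClass (VonNeumannAlgebra H) ℂ (H →L[ℂ] H) where
  smul_mem {S} c _ hx := S.toStarSubalgebra.smul_mem hx c

/-- A faithful, normal, semifinite trace on a von Neumann algebra `N`, with values in `[0, ∞]`
on the positive cone. Elements of `N` carry the usual order of operators (`x ≤ y` when `y - x` is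
a positive operator). Only the values of `toFun` at elements `x ≥ 0` carry meaning. -/
structure FaithfulNormalSemifiniteTrace (N : VonNeumannAlgebra H) where
  /-- The value of the trace at a positive element. -/
  toFun : N → ℝ≥0∞
  map_add : ∀ x y : N, 0 ≤ x → 0 ≤ y → toFun (x + y) = toFun x + toFun y
  map_smul : ∀ (c : ℝ≥0) (x : N), 0 ≤ x → toFun (c • x) = c * toFun x
  tracial : ∀ x : N, toFun (star x * x) = toFun (x * star x)
  faithful : ∀ x : N, 0 ≤ x → toFun x = 0 → x = 0
  normal : ∀ (S : Set N) (x : N), S.Nonempty → DirectedOn (· ≤ ·) S → (∀ y ∈ S, 0 ≤ y) →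
    IsLUB S x → IsLUB (toFun '' S) (toFun x)
  semifinite : ∀ x : N, 0 ≤ x →
    IsLUB (toFun '' {y : N | 0 ≤ y ∧ y ≤ x ∧ toFun y < ∞}) (toFun x)

variable {N : VonNeumannAlgebra H}

instance : CoeFun (FaithfulNormalSemifiniteTrace N) (fun _ => N → ℝ≥0∞) :=
  ⟨FaithfulNormalSemifiniteTrace.toFun⟩

variable (τ : FaithfulNormalSemifiniteTrace N)

/-- The norm-closed two-sided ideal of `N` generated by the projections of finite trace. -/
def compactIdeal : Ideal N :=
  (TwoSidedIdeal.span {e : N | IsStarProjection e ∧ τ e < ∞}).asIdeal.closure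

instance compactIdeal_isTwoSided : (compactIdeal τ).IsTwoSided where
  mul_mem_of_left {a} b ha := by
    have hmaps : Set.MapsTo (fun x : N => x * b)
        ((TwoSidedIdeal.span {e : N | IsStarProjection e ∧ τ e < ∞}).asIdeal : Set N)
        ((TwoSidedIdeal.span {e : N | IsStarProjection e ∧ τ e < ∞}).asIdeal : Set N) := by
      intro x hx
      exact TwoSidedIdeal.mul_mem_right _ _ _ hx
    exact hmaps.closure (continuous_id.mul continuous_const) ha

instance compactIdeal_isClosed : IsClosed (compactIdeal τ : Set N) := isClosed_closure

/-- The generalised Calkin algebra, the quotient of `N` by the ideal `compactIdeal τ`. It is a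
ring, and its norm is the quotient norm. -/
abbrev CalkinAlgebra : Type _ := N ⧸ compactIdeal τ

/-- The quotient map from `N` to the generalised Calkin algebra. -/
def calkinMap : N →+* CalkinAlgebra τ := Ideal.Quotient.mk (compactIdeal τ)

/-- The orthogonal projection onto the closure of a subspace. -/
def closureProj (K : Submodule ℂ H) : H →L[ℂ] H := K.topologicalClosure.starProjection

/-- The orthogonal projection onto the closure of the subspace `K` is an element of `N`, and its
trace is finite. -/
def HasFiniteProj (K : Submodule ℂ H) : Prop :=
  ∃ h : closureProj K ∈ N, τ ⟨closureProj K, h⟩ < ∞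

/-- The kernel of the restriction of `T` to the range of `Q`, a subspace of `H`. -/
def kerOn (Q T : N) : Submodule ℂ H :=
  (T : H →L[ℂ] H).ker ⊓ (Q : H →L[ℂ] H).range

/-- For projections `P`, `Q` in `N`, the operator `T` lies in the skew corner `P N Q` and is
`(P · Q)`-`τ`-Fredholm. -/
structure IsTauFredholm (P Q T : N) : Prop where
  mem_corner : ∃ S : N, T = P * S * Q
  finite_ker : HasFiniteProj τ (kerOn Q T)
  finite_ker_star : HasFiniteProj τ (kerOn P (star T))
  exists_proj : ∃ P₁ : N, IsStarProjection P₁ ∧ P₁ ≤ P ∧ τ (P - P₁) < ∞ ∧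
    (P₁ : H →L[ℂ] H).range ≤ (T : H →L[ℂ] H).range

end BreuerFredholm

end

/-!
Everything rests on one comparison of projections (`trace_le_of_injective`): if some `y` in `N` maps
the range of `e` injectively into the range of `f`, then `τ e ≤ τ f`. Put `x = y e`. The contractions
`v = x (x⋆x + ε)^{-1/2}` satisfy `v⋆v ↑ e` as `ε ↓ 0` and `v v⋆ ≤ f`, so that traciality and
normality of `τ` give the inequality. It follows that the elements whose range lies in a projection
of finite trace form a two-sided ideal (`IsFiniteRank`), and that a projection has finite trace as
soon as some element of this ideal is injective on its range (`IsFiniteRank.trace_lt_top`). Every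
projection that has to be shown finite is treated in this way; projections are seen to lie in `N`
because their ranges are invariant under the commutant.

If `P Q` is Fredholm and `P₁ ≤ P` is the projection it provides, the open mapping theorem bounds `Q`
below on `P₁ H`, and by duality `P₁` is bounded below on the closure `Q₁ H` of `Q P₁ H`. Hence
`‖P₁ - Q₁‖ < 1`, and `P - P₁`, `Q - Q₁` have finite trace (`norm_calkinMap_sub_lt_one`).

Conversely, if `‖π(P) - π(Q)‖ < 1`, there is `k` of finite rank with `‖P - Q - k‖ < 1`. On vectors
killed by `k` the difference `P - Q` is a strict contraction, which makes `k` injective on both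
kernels and `P Q` bounded below on `P H ∩ ker k`; the image of that subspace under `P Q` is closed,
contained in the range of `P Q`, and of finite codimension in `P H` relative to `τ`
(`isTauFredholm_of_norm_sub_lt`).
-/

namespace BreuerFredholm

variable {H : Type*} [NormedAddCommGroup H] [InnerProductSpace ℂ H] [CompleteSpace H]
variable {N : VonNeumannAlgebra H}

open ContinuousLinearMap Filter Topology

/-! ### Membership in a von Neumann algebra -/

lemma isStarProjection_coe_iff {e : N} :
    IsStarProjection (e : H →L[ℂ] H) ↔ IsStarProjection e := by
  refine ⟨fun h => ⟨Subtype.ext h.1, Subtype.ext h.2⟩, fun h => ⟨?_, ?_⟩⟩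
  · exact congrArg Subtype.val h.1
  · exact congrArg Subtype.val h.2

/-- The projection onto the closure of `K` lies in `N` as soon as `K` is invariant under the
commutant of `N`; `K` itself need not be closed. -/
lemma closureProj_mem {K : Submodule ℂ H} (hK : ∀ y ∈ N.commutant, ∀ z ∈ K, y z ∈ K) :
    closureProj K ∈ N := by
  rw [VonNeumannAlgebra.IsStarProjection.mem_iff (e := closureProj K)
    isStarProjection_starProjection]
  intro y hy
  rw [closureProj, Submodule.range_starProjection]
  intro z hz
  exact map_mem_closure y.continuous hz (hK y hy)

lemma isStarProjection_closureProj (K : Submodule ℂ H) : IsStarProjection (closureProj K) :=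
  isStarProjection_starProjection

lemma closureProj_apply_of_mem {K : Submodule ℂ H} {z : H} (hz : z ∈ K) : closureProj K z = z :=
  Submodule.starProjection_eq_self_iff.2 (K.le_topologicalClosure hz)

lemma mem_of_closureProj_apply {K : Submodule ℂ H} (hK : IsClosed (K : Set H)) {z : H}
    (hz : closureProj K z = z) : z ∈ K := by
  have := Submodule.starProjection_eq_self_iff.1 hz
  rwa [hK.submodule_topologicalClosure_eq] at this

lemma closureProj_apply_eq_zero_iff {K : Submodule ℂ H} {z : H} :
    closureProj K z = 0 ↔ z ∈ Kᗮ := by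
  rw [closureProj, Submodule.starProjection_apply_eq_zero_iff, Submodule.orthogonal_closure]

lemma commute_apply {y : H →L[ℂ] H} (hy : y ∈ N.commutant) (x : N) (z : H) :
    y ((x : H →L[ℂ] H) z) = (x : H →L[ℂ] H) (y z) := by
  have := VonNeumannAlgebra.mem_commutant_iff.1 hy x x.2
  exact (congrArg (fun T : H →L[ℂ] H => T z) this).symm

lemma cfc_mem (f : ℝ → ℝ) {a : H →L[ℂ] H} (ha : a ∈ N) : cfc f a ∈ N := by
  rw [← VonNeumannAlgebra.commutant_commutant N, VonNeumannAlgebra.mem_commutant_iff]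
  intro g hg
  have : Commute a g := VonNeumannAlgebra.mem_commutant_iff.1 hg a ha
  exact (this.cfc_real f).eq.symm

/-! ### Approximating the partial isometry of an operator -/

lemma sq_mul_inv_sqrt {t ε : ℝ} (ht : 0 ≤ t) (hε : 0 < ε) :
    (√(t + ε))⁻¹ * t * (√(t + ε))⁻¹ = t / (t + ε) := by
  have : (√(t + ε))⁻¹ * (√(t + ε))⁻¹ = (t + ε)⁻¹ := by
    rw [← mul_inv, Real.mul_self_sqrt (by positivity)]
  rw [mul_right_comm, this]; field_simp

/-- The operator `x (x⋆x + ε)^{-1/2}`; as `ε → 0` it approximates the partial isometry in the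
polar decomposition of `x`. -/
noncomputable def approxPolar (x : H →L[ℂ] H) (ε : ℝ) : H →L[ℂ] H :=
  x * cfc (fun t : ℝ => (√(t + ε))⁻¹) (star x * x)

lemma continuousOn_inv_sqrt (a : H →L[ℂ] H) (ha : 0 ≤ a) {ε : ℝ} (hε : 0 < ε) :
    ContinuousOn (fun t : ℝ => (√(t + ε))⁻¹) (spectrum ℝ a) := by
  refine ContinuousOn.inv₀ (by fun_prop) fun t ht => ?_
  have := spectrum_nonneg_of_nonneg ha ht
  positivity

lemma continuousOn_div_add (a : H →L[ℂ] H) (ha : 0 ≤ a) {ε : ℝ} (hε : 0 < ε) :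
    ContinuousOn (fun t : ℝ => t / (t + ε)) (spectrum ℝ a) := by
  refine ContinuousOn.div (by fun_prop) (by fun_prop) fun t ht => ?_
  have := spectrum_nonneg_of_nonneg ha ht
  positivity

lemma star_approxPolar_mul_self (x : H →L[ℂ] H) {ε : ℝ} (hε : 0 < ε) :
    star (approxPolar x ε) * approxPolar x ε = cfc (fun t : ℝ => t / (t + ε)) (star x * x) := by
  have ha : 0 ≤ star x * x := star_mul_self_nonneg x
  have hsa : IsSelfAdjoint (star x * x) := ha.isSelfAdjoint
  set a := star x * x with ha'
  have hq := continuousOn_inv_sqrt a ha hε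
  rw [approxPolar, star_mul, ← ha', (cfc_predicate (fun t : ℝ => (√(t + ε))⁻¹) a).star_eq,
    mul_assoc, ← mul_assoc (star x), ← ha', ← mul_assoc]
  nth_rw 2 [← cfc_id' ℝ a]
  rw [← cfc_mul _ _ a hq (by fun_prop),
    ← cfc_mul (fun t : ℝ => (√(t + ε))⁻¹ * t) _ a (hq.mul (by fun_prop)) hq]
  refine cfc_congr fun t ht => ?_
  exact sq_mul_inv_sqrt (spectrum_nonneg_of_nonneg ha ht) hε

lemma norm_approxPolar_le (x : H →L[ℂ] H) {ε : ℝ} (hε : 0 < ε) : ‖approxPolar x ε‖ ≤ 1 := by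
  have h : ‖approxPolar x ε‖ * ‖approxPolar x ε‖ ≤ 1 := by
    rw [← CStarRing.norm_star_mul_self, star_approxPolar_mul_self x hε]
    refine norm_cfc_le zero_le_one fun t ht => ?_
    have := spectrum_nonneg_of_nonneg (star_mul_self_nonneg x) ht
    rw [Real.norm_of_nonneg (by positivity), div_le_one (by positivity)]
    linarith
  nlinarith [norm_nonneg (approxPolar x ε)]

lemma approxPolar_mem {x : H →L[ℂ] H} (hx : x ∈ N) (ε : ℝ) : approxPolar x ε ∈ N :=
  mul_mem hx (cfc_mem _ (mul_mem (star_mem hx) hx))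

lemma star_approxPolar_mul_self_anti (x : H →L[ℂ] H) {ε δ : ℝ} (hδ : 0 < δ) (h : δ ≤ ε) :
    star (approxPolar x ε) * approxPolar x ε ≤ star (approxPolar x δ) * approxPolar x δ := by
  have ha : 0 ≤ star x * x := star_mul_self_nonneg x
  have hε := hδ.trans_le h
  rw [star_approxPolar_mul_self x hε, star_approxPolar_mul_self x hδ]
  refine cfc_mono (fun t ht => ?_) (continuousOn_div_add _ ha hε) (continuousOn_div_add _ ha hδ)
  have := spectrum_nonneg_of_nonneg ha ht
  gcongr

lemma norm_star_approxPolar_mul_self_sub_le (x : H →L[ℂ] H) {ε : ℝ} (hε : 0 < ε) :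
    ‖star (approxPolar x ε) * approxPolar x ε * (star x * x) - star x * x‖ ≤ ε := by
  have ha : 0 ≤ star x * x := star_mul_self_nonneg x
  have hsa : IsSelfAdjoint (star x * x) := ha.isSelfAdjoint
  rw [star_approxPolar_mul_self x hε]
  set a := star x * x
  have hc := continuousOn_div_add a ha hε
  nth_rw 2 3 [← cfc_id' ℝ a]
  rw [← cfc_mul _ _ a hc (by fun_prop),
    ← cfc_sub (fun t : ℝ => t / (t + ε) * t) _ a (hc.mul (by fun_prop)) (by fun_prop)]
  refine norm_cfc_le hε.le fun t ht => ?_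
  have := spectrum_nonneg_of_nonneg ha ht
  have h2 : t / (t + ε) * t - t = - (ε * (t / (t + ε))) := by field_simp; ring
  rw [h2, norm_neg, Real.norm_of_nonneg (by positivity)]
  exact mul_le_of_le_one_right hε.le ((div_le_one (by positivity)).2 (by linarith))

lemma approxPolar_mul {x e : H →L[ℂ] H} (he : IsSelfAdjoint e) (hxe : x * e = x) (ε : ℝ) :
    approxPolar x ε * e = approxPolar x ε := by
  have h1 : e * star x = star x := by
    have := congrArg star hxe
    rwa [star_mul, he.star_eq] at this
  have hc : Commute (star x * x) e := by
    rw [Commute, SemiconjBy, mul_assoc, hxe, ← mul_assoc, h1]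
  rw [approxPolar, mul_assoc, (hc.cfc_real _).eq, ← mul_assoc, hxe]

/-- A contraction `v` with `v = v e` satisfies `v⋆v ≤ e`. -/
lemma star_mul_self_le_of_mul_eq {v e : H →L[ℂ] H} (he : IsStarProjection e) (hv : ‖v‖ ≤ 1)
    (hve : v * e = v) : star v * v ≤ e := by
  have h1 : star v * v ≤ 1 := by
    refine (CStarAlgebra.norm_le_one_iff_of_nonneg _ (star_mul_self_nonneg v)).1 ?_
    rw [CStarRing.norm_star_mul_self]
    exact mul_le_one₀ hv (norm_nonneg _) hv
  have h2 := star_left_conjugate_le_conjugate h1 e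
  rwa [mul_one, he.2.star_eq, he.1.eq, mul_assoc, mul_assoc, hve, ← mul_assoc,
    show e * star v = star v by
      have := congrArg star hve
      rwa [star_mul, he.2.star_eq] at this] at h2

/-- If `e` is the support of `x` (that is, `x = x e` and `x` is injective on the range of `e`), then
`e` is the least upper bound of the operators `v⋆v = x⋆x (x⋆x + ε)⁻¹`, where `v = approxPolar x ε`
and `ε = 1 / (n + 1)`. This is the minimality half. -/
lemma le_of_forall_approxPolar_le {x e b : H →L[ℂ] H} (he : IsStarProjection e) (hxe : x * e = x)
    (hinj : ∀ z, e z = z → x z = 0 → z = 0) (hb : IsSelfAdjoint b)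
    (h : ∀ n : ℕ, star (approxPolar x (1 / (n + 1))) * approxPolar x (1 / (n + 1)) ≤ b) :
    e ≤ b := by
  set f : ℕ → H →L[ℂ] H := fun n =>
    star (approxPolar x (1 / (n + 1))) * approxPolar x (1 / (n + 1)) with hf
  set a := star x * x with ha
  have hex : e * star x = star x := by
    have := congrArg star hxe
    rwa [star_mul, he.2.star_eq] at this
  -- On the range of `a` the approximants converge to the identity, on `ker e` they vanish.
  have hlim : ∀ z ∈ a.range ⊔ e.ker, Tendsto (fun n => f n z) atTop (𝓝 (e z)) := by
    intro z hz
    obtain ⟨_, ⟨y, rfl⟩, w, hw, rfl⟩ := Submodule.mem_sup.1 hz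
    have hw' : e w = 0 := hw
    have hfw : ∀ n, f n w = 0 := fun n => by
      have := approxPolar_mul he.2 hxe (1 / ((n : ℝ) + 1))
      simp only [hf]
      rw [← this, ← mul_assoc, mul_apply_eq_comp, hw', map_zero]
    have hea : e (a y) = a y := by
      change (e * a) y = a y
      rw [ha, ← mul_assoc, hex]
    simp only [map_add, hfw, hw', add_zero]
    change Tendsto (fun n => f n (a y)) atTop (𝓝 (e (a y)))
    rw [hea, tendsto_iff_norm_sub_tendsto_zero]
    have h0 : Tendsto (fun n : ℕ => (1 / ((n : ℝ) + 1)) * ‖y‖) atTop (𝓝 0) := by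
      simpa using tendsto_one_div_add_atTop_nhds_zero_nat.mul_const ‖y‖
    refine squeeze_zero (fun _ => norm_nonneg _) (fun n => ?_) h0
    have h1 := norm_star_approxPolar_mul_self_sub_le x (ε := 1 / ((n : ℝ) + 1)) (by positivity)
    exact (f n * a - a).le_of_opNorm_le h1 y
  have hdense : (a.range ⊔ e.ker).topologicalClosure = ⊤ := by
    rw [Submodule.topologicalClosure_eq_top_iff, ← Submodule.inf_orthogonal, eq_bot_iff]
    rintro u ⟨hu1, hu2⟩
    have hau : a u = 0 := by
      have hsa : star a = a := (IsSelfAdjoint.star_mul_self x).star_eq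
      have : u ∈ a.rangeᗮ := hu1
      rw [ContinuousLinearMap.orthogonal_range, ← ContinuousLinearMap.star_eq_adjoint, hsa] at this
      exact this
    have hxu : x u = 0 := by
      have h1 : u ∈ (x.adjoint ∘L x).ker := hau
      rw [ContinuousLinearMap.ker_adjoint_comp_self] at h1
      exact h1
    have heu : e u = u := by
      have h1 : e (u - e u) = 0 := by
        rw [map_sub, ← mul_apply_eq_comp, he.1.eq, sub_self]
      have h2 : inner ℂ (u - e u) u = 0 := hu2 (u - e u) h1
      have h3 : inner ℂ (u - e u) (e u) = 0 := by
        rw [← ContinuousLinearMap.adjoint_inner_left, ← ContinuousLinearMap.star_eq_adjoint,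
          he.2.star_eq, h1, inner_zero_left]
      have h4 : inner ℂ (u - e u) (u - e u) = 0 := by rw [inner_sub_right, h2, h3, sub_zero]
      exact (sub_eq_zero.1 (inner_self_eq_zero.1 h4)).symm
    exact hinj u heu hxu
  rw [ContinuousLinearMap.le_def, ContinuousLinearMap.isPositive_def']
  refine ⟨hb.sub he.2, fun z => ?_⟩
  rw [ContinuousLinearMap.reApplyInnerSelf_apply]
  have hclosed : IsClosed {z : H | 0 ≤ RCLike.re (inner ℂ ((b - e) z) z)} :=
    isClosed_le continuous_const (by fun_prop)
  have hz : z ∈ closure ((a.range ⊔ e.ker : Submodule ℂ H) : Set H) := by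
    have : z ∈ (a.range ⊔ e.ker).topologicalClosure := hdense ▸ Submodule.mem_top
    exact this
  refine closure_minimal (fun z hz => ?_) hclosed hz
  have h1 : Tendsto (fun n => RCLike.re (inner ℂ ((b - f n) z) z)) atTop
      (𝓝 (RCLike.re (inner ℂ ((b - e) z) z))) := by
    refine (RCLike.continuous_re.tendsto _).comp (Filter.Tendsto.inner ?_ tendsto_const_nhds)
    simp only [sub_apply]
    exact tendsto_const_nhds.sub (hlim z hz)
  exact ge_of_tendsto' h1 fun n =>
    ((ContinuousLinearMap.isPositive_def'.1 ((ContinuousLinearMap.le_def _ _).1 (h n))).2 z)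

/-! ### Comparison of projections by the trace -/

variable {τ : FaithfulNormalSemifiniteTrace N}

lemma trace_mono {x y : N} (hx : 0 ≤ x) (hxy : x ≤ y) : τ x ≤ τ y := by
  have h : 0 ≤ y - x := sub_nonneg.2 hxy
  calc τ x ≤ τ x + τ (y - x) := le_self_add
    _ = τ y := by rw [← τ.map_add x _ hx h, add_sub_cancel]

/-- Comparison of projections: if some `y` in `N` maps the range of `e` injectively into the range
of `f`, then `τ e ≤ τ f`. With `v` running through the approximations to the partial isometry of
`y e`, the operators `v⋆v` increase to `e`, while `v v⋆ ≤ f` has the same trace as `v⋆v`; normality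
of `τ` gives the bound without any polar decomposition in `N`. -/
theorem trace_le_of_injective {e f y : N} (he : IsStarProjection e) (hf : IsStarProjection f)
    (hfy : f * y = y)
    (hinj : ∀ z : H, (e : H →L[ℂ] H) z = z → (y : H →L[ℂ] H) z = 0 → z = 0) : τ e ≤ τ f := by
  have he' := isStarProjection_coe_iff.2 he
  have hf' := isStarProjection_coe_iff.2 hf
  set x : N := y * e with hx
  have hxe : (x : H →L[ℂ] H) * e = x := by
    exact congrArg Subtype.val (show x * e = x by rw [hx, mul_assoc, he.1.eq])
  have hfx : (f : H →L[ℂ] H) * x = x := by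
    exact congrArg Subtype.val (show f * x = x by rw [hx, ← mul_assoc, hfy])
  have hxinj : ∀ z : H, (e : H →L[ℂ] H) z = z → (x : H →L[ℂ] H) z = 0 → z = 0 := by
    intro z h1 h2
    refine hinj z h1 ?_
    rw [← h2]
    change _ = (y : H →L[ℂ] H) ((e : H →L[ℂ] H) z)
    rw [h1]
  let v : ℕ → N := fun n => ⟨approxPolar (x : H →L[ℂ] H) (1 / (n + 1)), approxPolar_mem x.2 _⟩
  have hv : ∀ n, ‖(v n : H →L[ℂ] H)‖ ≤ 1 := fun n => norm_approxPolar_le _ (by positivity)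
  have hmono : Monotone fun n => star (v n) * v n := by
    intro m n hmn
    exact star_approxPolar_mul_self_anti (x : H →L[ℂ] H) (by positivity)
      (one_div_le_one_div_of_le (by positivity) (by gcongr))
  have hpos : ∀ w : N, 0 ≤ star w * w := fun w => star_mul_self_nonneg (w : H →L[ℂ] H)
  have hlub : IsLUB (Set.range fun n => star (v n) * v n) e := by
    constructor
    · rintro _ ⟨n, rfl⟩
      exact star_mul_self_le_of_mul_eq he' (hv n) (approxPolar_mul he'.2 hxe _)
    · intro b hb
      have hb0 : (0 : H →L[ℂ] H) ≤ b := (hpos (v 0)).trans (hb ⟨0, rfl⟩)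
      exact le_of_forall_approxPolar_le he' hxe hxinj hb0.isSelfAdjoint fun n => hb ⟨n, rfl⟩
  refine (isLUB_le_iff (τ.normal _ _ (Set.range_nonempty _) (hmono.directed_le.directedOn_range)
    (by rintro _ ⟨n, rfl⟩; exact hpos _) hlub)).2 ?_
  rintro _ ⟨_, ⟨n, rfl⟩, rfl⟩
  rw [τ.tracial]
  have h1 : (v n : H →L[ℂ] H) * star (v n : H →L[ℂ] H) ≤ f := by
    have := star_mul_self_le_of_mul_eq (v := star (v n : H →L[ℂ] H)) hf'
      ((norm_star _).trans_le (hv n)) (by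
        have h2 : (f : H →L[ℂ] H) * v n = v n := by
          change (f : H →L[ℂ] H) * (x * _) = x * _
          rw [← mul_assoc, hfx]
        have h3 := congrArg star h2
        rwa [star_mul, hf'.2.star_eq] at h3)
    rwa [star_star] at this
  exact trace_mono (mul_star_self_nonneg (v n : H →L[ℂ] H)) h1

/-! ### Projections on a Hilbert space -/

lemma proj_apply_self {p : H →L[ℂ] H} (hp : IsStarProjection p) (x : H) : p (p x) = p x :=
  congrArg (fun T : H →L[ℂ] H => T x) hp.1.eq

lemma mem_range_proj_iff {p : H →L[ℂ] H} (hp : IsStarProjection p) {x : H} :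
    x ∈ p.range ↔ p x = x :=
  ⟨by rintro ⟨y, rfl⟩; exact proj_apply_self hp y, fun h => ⟨x, h⟩⟩

lemma inner_proj {p : H →L[ℂ] H} (hp : IsStarProjection p) (x y : H) :
    inner ℂ (p x) y = inner ℂ x (p y) := by
  rw [← ContinuousLinearMap.adjoint_inner_right, ← ContinuousLinearMap.star_eq_adjoint,
    hp.2.star_eq]

lemma norm_sq_proj {p : H →L[ℂ] H} (hp : IsStarProjection p) (x : H) :
    ‖x‖ ^ 2 = ‖p x‖ ^ 2 + ‖x - p x‖ ^ 2 := by
  have h : inner ℂ (p x) (x - p x) = 0 := by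
    rw [inner_proj hp, map_sub, proj_apply_self hp, sub_self, inner_zero_right]
  have := norm_add_sq_eq_norm_sq_add_norm_sq_of_inner_eq_zero _ _ h
  rw [add_sub_cancel] at this
  rw [pow_two, this, pow_two, pow_two]

lemma proj_le_iff {p q : N} (hp : IsStarProjection p) (hq : IsStarProjection q) :
    p ≤ q ↔ q * p = p := by
  have h := IsStarProjection.le_iff_mul_eq_right (isStarProjection_coe_iff.2 hp)
    (isStarProjection_coe_iff.2 hq)
  exact h.trans ⟨fun h => Subtype.ext h, fun h => congrArg Subtype.val h⟩

lemma isStarProjection_sub {p q : N} (hp : IsStarProjection p) (hq : IsStarProjection q)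
    (h : q * p = p) : IsStarProjection (q - p) := by
  have h' : p * q = p := by
    have := congrArg star h
    rwa [star_mul, hp.2.star_eq, hq.2.star_eq] at this
  refine ⟨?_, hq.2.sub hp.2⟩
  rw [IsIdempotentElem, sub_mul, mul_sub, mul_sub, hq.1.eq, hp.1.eq, h, h', sub_self, sub_zero]

/-- The projection onto the closure of the range of an element of `N`, as an element of `N`. -/
noncomputable def rangeProj (x : N) : N :=
  ⟨closureProj (x : H →L[ℂ] H).range, closureProj_mem (by
    rintro y hy _ ⟨z, rfl⟩
    exact ⟨y z, (commute_apply hy x z).symm⟩)⟩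

lemma isStarProjection_rangeProj (x : N) : IsStarProjection (rangeProj x) :=
  isStarProjection_coe_iff.1 (isStarProjection_closureProj _)

lemma rangeProj_mul_self (x : N) : rangeProj x * x = x := by
  refine Subtype.ext (ContinuousLinearMap.ext fun z => ?_)
  exact closureProj_apply_of_mem (K := (x : H →L[ℂ] H).range) ⟨z, rfl⟩

lemma rangeProj_apply_eq_zero_iff {x : N} {z : H} :
    (rangeProj x : H →L[ℂ] H) z = 0 ↔ ((star x : N) : H →L[ℂ] H) z = 0 := by
  refine closureProj_apply_eq_zero_iff.trans ?_
  rw [ContinuousLinearMap.orthogonal_range]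
  rfl

/-! ### The ideal of elements of finite rank -/

variable (τ) in
/-- An element of `N` has finite rank if its range lies in that of a projection of finite trace.
These elements form the (algebraic) two-sided ideal generated by the projections of finite
trace. -/
def IsFiniteRank (x : N) : Prop :=
  ∃ f : N, IsStarProjection f ∧ τ f < ∞ ∧ f * x = x

lemma IsFiniteRank.of_proj {e : N} (he : IsStarProjection e) (h : τ e < ∞) : IsFiniteRank τ e :=
  ⟨e, he, h, he.1.eq⟩

lemma IsFiniteRank.zero : IsFiniteRank τ (0 : N) := by
  refine ⟨0, .zero _, ?_, zero_mul _⟩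
  have h := τ.map_smul 0 0 le_rfl
  rw [smul_zero, ENNReal.coe_zero, zero_mul] at h
  rw [h]
  exact ENNReal.zero_lt_top

lemma IsFiniteRank.neg {x : N} (h : IsFiniteRank τ x) : IsFiniteRank τ (-x) := by
  obtain ⟨f, hf, hτ, hx⟩ := h
  exact ⟨f, hf, hτ, by rw [mul_neg, hx]⟩

lemma IsFiniteRank.mul_right {x : N} (h : IsFiniteRank τ x) (b : N) : IsFiniteRank τ (x * b) := by
  obtain ⟨f, hf, hτ, hx⟩ := h
  exact ⟨f, hf, hτ, by rw [← mul_assoc, hx]⟩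

/-- A projection on whose range an element of finite rank is injective has finite trace. -/
lemma IsFiniteRank.trace_lt_top {y : N} (h : IsFiniteRank τ y) {e : N} (he : IsStarProjection e)
    (hinj : ∀ z : H, (e : H →L[ℂ] H) z = z → (y : H →L[ℂ] H) z = 0 → z = 0) : τ e < ∞ := by
  obtain ⟨f, hf, hτ, hx⟩ := h
  exact (trace_le_of_injective he hf hx hinj).trans_lt hτ

/-- The range projection of `b x` is compared with `f ≥ [x]` through the operator `f b⋆`, which is
injective on the closure of the range of `b x`. -/
lemma IsFiniteRank.mul_left {x : N} (h : IsFiniteRank τ x) (b : N) : IsFiniteRank τ (b * x) := by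
  obtain ⟨f, hf, hτ, hx⟩ := h
  have hfb : IsFiniteRank τ (f * star b) := (IsFiniteRank.of_proj hf hτ).mul_right _
  refine ⟨rangeProj (b * x), isStarProjection_rangeProj _,
    hfb.trace_lt_top (isStarProjection_rangeProj _) fun z hz h0 => ?_, rangeProj_mul_self _⟩
  rw [← hz, rangeProj_apply_eq_zero_iff]
  have h1 : star (b * x) = star x * (f * star b) := by
    conv_lhs => rw [← hx]
    rw [star_mul, star_mul, hf.2.star_eq, mul_assoc]
  have h2 : ((star (b * x) : N) : H →L[ℂ] H) z =
      ((star x : N) : H →L[ℂ] H) (((f * star b : N) : H →L[ℂ] H) z) :=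
    congrArg (fun T : N => (T : H →L[ℂ] H) z) h1
  exact h2.trans ((congrArg _ h0).trans (map_zero _))

/-- The kernel of `x⋆x + y⋆y` is the intersection of the kernels of `x` and `y`. -/
lemma apply_eq_zero_of_star_mul_add {x y : H →L[ℂ] H} {z : H}
    (h : (star x * x + star y * y) z = 0) : x z = 0 ∧ y z = 0 := by
  have h1 : ∀ w : H →L[ℂ] H, inner ℂ ((star w * w) z) z = ((‖w z‖ ^ 2 : ℝ) : ℂ) := fun w => by
    change inner ℂ (w.adjoint (w z)) z = _
    rw [ContinuousLinearMap.adjoint_inner_left, inner_self_eq_norm_sq_to_K]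
    norm_cast
  have h2 : inner ℂ ((star x * x + star y * y) z) z = 0 := by rw [h, inner_zero_left]
  rw [add_apply, inner_add_left, h1, h1, ← Complex.ofReal_add, Complex.ofReal_eq_zero] at h2
  have h3 := sq_nonneg ‖x z‖
  have h4 := sq_nonneg ‖y z‖
  exact ⟨norm_eq_zero.1 (pow_eq_zero_iff two_ne_zero |>.1 (by linarith)),
    norm_eq_zero.1 (pow_eq_zero_iff two_ne_zero |>.1 (by linarith))⟩

lemma apply_eq_zero_of_proj_add {p q : N} (hp : IsStarProjection p) (hq : IsStarProjection q)
    {z : H} (h : ((p + q : N) : H →L[ℂ] H) z = 0) : (p : H →L[ℂ] H) z = 0 ∧ (q : H →L[ℂ] H) z = 0 := by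
  have hp' := isStarProjection_coe_iff.2 hp
  have hq' := isStarProjection_coe_iff.2 hq
  refine apply_eq_zero_of_star_mul_add ?_
  rw [hp'.2.star_eq, hq'.2.star_eq, hp'.1.eq, hq'.1.eq]
  exact h

/-- The supremum `r` of `f` and `g` has finite trace, since `g` is injective on the range of
`r - f`. -/
lemma IsFiniteRank.add {x y : N} (hx : IsFiniteRank τ x) (hy : IsFiniteRank τ y) :
    IsFiniteRank τ (x + y) := by
  obtain ⟨f, hf, hτf, hx⟩ := hx
  obtain ⟨g, hg, hτg, hy⟩ := hy
  set r := rangeProj (f + g) with hr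
  have hrp : IsStarProjection r := isStarProjection_rangeProj _
  have hsa : star (f + g) = f + g := (hf.2.add hg.2).star_eq
  -- The kernel of `r` is the kernel of `f + g`, the intersection of the two kernels.
  have hker : ∀ z : H, (r : H →L[ℂ] H) z = 0 →
      (f : H →L[ℂ] H) z = 0 ∧ (g : H →L[ℂ] H) z = 0 := fun z hz => by
    rw [hr, rangeProj_apply_eq_zero_iff] at hz
    exact apply_eq_zero_of_proj_add hf hg
      ((congrArg (fun T : N => (T : H →L[ℂ] H) z) hsa).symm.trans hz)
  have habs : ∀ p : N, IsStarProjection p →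
      (∀ z : H, (r : H →L[ℂ] H) z = 0 → (p : H →L[ℂ] H) z = 0) → r * p = p := by
    intro p hp hpz
    have h1 : p * r = p := by
      refine Subtype.ext (ContinuousLinearMap.ext fun z => ?_)
      have h2 := hpz (z - (r : H →L[ℂ] H) z) (by
        rw [map_sub, proj_apply_self (isStarProjection_coe_iff.2 hrp), sub_self])
      rw [map_sub, sub_eq_zero] at h2
      exact h2.symm
    have := congrArg star h1
    rwa [star_mul, hp.2.star_eq, hrp.2.star_eq] at this
  have hrf : r * f = f := habs f hf fun z hz => (hker z hz).1
  have hrg : r * g = g := habs g hg fun z hz => (hker z hz).2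
  have hd : IsStarProjection (r - f) := isStarProjection_sub hf hrp hrf
  have hfr : f * r = f := by
    have := congrArg star hrf
    rwa [star_mul, hf.2.star_eq, hrp.2.star_eq] at this
  have hτd : τ (r - f) < ∞ := by
    refine (IsFiniteRank.of_proj hg hτg).trace_lt_top hd fun z hz hgz => ?_
    have hfz : (f : H →L[ℂ] H) z = 0 := by
      rw [← hz]
      exact congrArg (fun T : N => (T : H →L[ℂ] H) z)
        (show f * (r - f) = 0 by rw [mul_sub, hfr, hf.1.eq, sub_self])
    have hrz : (r : H →L[ℂ] H) z = 0 := by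
      rw [hr, rangeProj_apply_eq_zero_iff]
      refine (congrArg (fun T : N => (T : H →L[ℂ] H) z) hsa).trans ?_
      change (f : H →L[ℂ] H) z + (g : H →L[ℂ] H) z = 0
      rw [hfz, hgz, add_zero]
    rw [← hz]
    change (r : H →L[ℂ] H) z - (f : H →L[ℂ] H) z = 0
    rw [hrz, hfz, sub_zero]
  refine ⟨r, hrp, ?_, ?_⟩
  · have h1 : (0 : N) ≤ f := (isStarProjection_coe_iff.2 hf).nonneg
    have h2 : (0 : N) ≤ r - f := (isStarProjection_coe_iff.2 hd).nonneg
    rw [← add_sub_cancel f r, τ.map_add _ _ h1 h2]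
    exact ENNReal.add_lt_top.2 ⟨hτf, hτd⟩
  · rw [mul_add]
    congr 1
    · rw [← hx, ← mul_assoc, hrf]
    · rw [← hy, ← mul_assoc, hrg]

lemma isFiniteRank_of_mem_span {x : N}
    (hx : x ∈ TwoSidedIdeal.span {e : N | IsStarProjection e ∧ τ e < ∞}) : IsFiniteRank τ x := by
  let I : TwoSidedIdeal N := TwoSidedIdeal.mk' {x | IsFiniteRank τ x} IsFiniteRank.zero
    IsFiniteRank.add IsFiniteRank.neg (fun h => h.mul_left _) (fun h => h.mul_right _)
  have hI : ∀ y, y ∈ I ↔ IsFiniteRank τ y := fun y => TwoSidedIdeal.mem_mk' {x | IsFiniteRank τ x}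
    IsFiniteRank.zero IsFiniteRank.add IsFiniteRank.neg (fun h => h.mul_left _)
    (fun h => h.mul_right _) y
  have h : TwoSidedIdeal.span {e : N | IsStarProjection e ∧ τ e < ∞} ≤ I := by
    rw [TwoSidedIdeal.span_le]
    rintro e ⟨he, h⟩
    exact (hI e).2 (IsFiniteRank.of_proj he h)
  exact (hI x).1 (h hx)

lemma mem_compactIdeal_of_proj {e : N} (he : IsStarProjection e) (h : τ e < ∞) :
    e ∈ compactIdeal τ := by
  have h1 : e ∈ TwoSidedIdeal.span {e : N | IsStarProjection e ∧ τ e < ∞} :=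
    TwoSidedIdeal.subset_span ⟨he, h⟩
  have h2 : e ∈ (TwoSidedIdeal.span {e : N | IsStarProjection e ∧ τ e < ∞}).asIdeal :=
    TwoSidedIdeal.mem_asIdeal.2 h1
  exact subset_closure (SetLike.mem_coe.2 h2)

lemma hasFiniteProj_of_injective {K : Submodule ℂ H} (hcl : IsClosed (K : Set H))
    (hK : ∀ y ∈ N.commutant, ∀ z ∈ K, y z ∈ K) {y : N} (hy : IsFiniteRank τ y)
    (hinj : ∀ z ∈ K, (y : H →L[ℂ] H) z = 0 → z = 0) : HasFiniteProj τ K :=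
  ⟨closureProj_mem hK, hy.trace_lt_top
    (isStarProjection_coe_iff.1 (isStarProjection_closureProj K)) fun z hz =>
    hinj z (mem_of_closureProj_apply hcl hz)⟩

lemma norm_calkinMap_le (x : N) : ‖calkinMap τ x‖ ≤ ‖x‖ :=
  Submodule.Quotient.norm_mk_le (compactIdeal τ) x

lemma calkinMap_eq_of_sub_mem {x y : N} (h : x - y ∈ compactIdeal τ) :
    calkinMap τ x = calkinMap τ y :=
  Ideal.Quotient.eq.2 h

lemma exists_isFiniteRank_norm_sub_lt {x : N} {c : ℝ} (h : ‖calkinMap τ x‖ < c) :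
    ∃ k : N, IsFiniteRank τ k ∧ ‖x - k‖ < c := by
  obtain ⟨m, hm, hmn⟩ :=
    Submodule.Quotient.norm_mk_lt (S := compactIdeal τ) (calkinMap τ x) (sub_pos.2 h)
  have hmc : ‖m‖ < c := hmn.trans_eq (add_sub_cancel _ _)
  have h1 : x - m ∈ compactIdeal τ := Ideal.Quotient.eq.1 hm.symm
  obtain ⟨k, hk, hkd⟩ := Metric.mem_closure_iff.1 h1 (c - ‖m‖) (sub_pos.2 hmc)
  refine ⟨k, isFiniteRank_of_mem_span hk, ?_⟩
  rw [dist_eq_norm] at hkd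
  calc ‖x - k‖ = ‖m + (x - m - k)‖ := by congr 1; abel
    _ ≤ ‖m‖ + ‖x - m - k‖ := norm_add_le _ _
    _ < c := by linarith

/-! ### From the Fredholm property to the norm estimate -/

/-- Here `(p - q) z` is the difference of the orthogonal vectors `p (1 - q) z` and
`(1 - p) q z`. -/
lemma norm_sub_le_of_gap {p q : H →L[ℂ] H} (hp : IsStarProjection p) (hq : IsStarProjection q)
    {s : ℝ} (hs : 0 ≤ s) (h1 : ∀ x, q x = x → ‖x - p x‖ ≤ s * ‖x‖)
    (h2 : ∀ x, p x = x → ‖x - q x‖ ≤ s * ‖x‖) : ‖p - q‖ ≤ s := by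
  -- The bound on `(1 - q) p` passes to its adjoint `p (1 - q)`.
  have h3 : ∀ w, q w = 0 → ‖p w‖ ≤ s * ‖w‖ := by
    intro w hw
    have h4 : ‖p w‖ ^ 2 = RCLike.re (inner ℂ (p w - q (p w)) w) := by
      rw [inner_sub_left, inner_proj hq, hw, inner_zero_right, sub_zero,
        ← proj_apply_self hp w, inner_proj hp, proj_apply_self hp, inner_self_eq_norm_sq]
    have h5 : RCLike.re (inner ℂ (p w - q (p w)) w) ≤ s * ‖p w‖ * ‖w‖ :=
      (re_inner_le_norm _ _).trans
        (mul_le_mul_of_nonneg_right (h2 _ (proj_apply_self hp w)) (norm_nonneg _))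
    by_contra! hlt
    nlinarith [norm_nonneg (p w), mul_nonneg hs (norm_nonneg w)]
  refine opNorm_le_bound _ hs fun z => ?_
  have hd := norm_sq_proj hp ((p - q) z)
  have e1 : p ((p - q) z) = p (z - q z) := by simp [proj_apply_self hp]
  have e2 : (p - q) z - p ((p - q) z) = -(q z - p (q z)) := by
    simp [proj_apply_self hp]
  rw [e2, e1, norm_neg] at hd
  have b1 : ‖p (z - q z)‖ ≤ s * ‖z - q z‖ :=
    h3 _ (by rw [map_sub, proj_apply_self hq, sub_self])
  have b2 : ‖q z - p (q z)‖ ≤ s * ‖q z‖ := h1 _ (proj_apply_self hq z)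
  have hz := norm_sq_proj hq z
  have b1' := pow_le_pow_left₀ (norm_nonneg _) b1 2
  have b2' := pow_le_pow_left₀ (norm_nonneg _) b2 2
  refine le_of_sq_le_sq ?_ (by positivity)
  rw [hd, mul_pow, hz]
  rw [mul_pow] at b1' b2'
  linarith

/-- If the range of an operator `T` contains the range of a projection `p`, then `T⋆` is bounded
below on the range of `p`, by the open mapping theorem. -/
lemma exists_norm_le_of_range_le {p T : H →L[ℂ] H} (hp : IsStarProjection p)
    (h : p.range ≤ T.range) :
    ∃ C : ℝ, 0 < C ∧ ∀ x, p x = x → ‖x‖ ≤ C * ‖(star T : H →L[ℂ] H) x‖ := by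
  have hcl : IsClosed (p.range : Set H) := IsIdempotentElem.isClosed_range hp.1
  have : CompleteSpace p.range := hcl.completeSpace_coe
  let L : H →L[ℂ] p.range := (p * T).codRestrict p.range fun x => ⟨T x, rfl⟩
  have hL : Function.Surjective L := by
    rintro ⟨y, hy⟩
    obtain ⟨w, hw⟩ := h hy
    refine ⟨w, Subtype.ext ?_⟩
    change p (T w) = y
    exact (congrArg p hw).trans ((mem_range_proj_iff hp).1 hy)
  obtain ⟨C, hC, hpre⟩ := L.exists_preimage_norm_le hL
  refine ⟨C, hC, fun x hx => ?_⟩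
  obtain ⟨w, hw, hwn⟩ := hpre ⟨x, (mem_range_proj_iff hp).2 hx⟩
  have hw' : p (T w) = x := congrArg Subtype.val hw
  have h1 : ‖x‖ ^ 2 ≤ ‖(star T : H →L[ℂ] H) x‖ * (C * ‖x‖) := by
    calc ‖x‖ ^ 2 = RCLike.re (inner ℂ x (p (T w))) := by rw [hw', inner_self_eq_norm_sq]
      _ = RCLike.re (inner ℂ ((star T : H →L[ℂ] H) x) w) := by
        rw [← inner_proj hp, hx, ContinuousLinearMap.star_eq_adjoint,
          ContinuousLinearMap.adjoint_inner_left]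
      _ ≤ ‖(star T : H →L[ℂ] H) x‖ * ‖w‖ := re_inner_le_norm _ _
      _ ≤ _ := by gcongr; exact hwn
  rcases (norm_nonneg x).eq_or_lt with h0 | h0
  · rw [← h0]; positivity
  · have : ‖x‖ * ‖x‖ ≤ C * ‖(star T : H →L[ℂ] H) x‖ * ‖x‖ := by nlinarith
    exact le_of_mul_le_mul_right this h0

lemma norm_sub_proj_le {p : H →L[ℂ] H} (hp : IsStarProjection p) {D : ℝ} (hD : 0 < D) {x : H}
    (h : ‖x‖ ≤ D * ‖p x‖) : ‖x - p x‖ ≤ √(1 - (D ^ 2)⁻¹) * ‖x‖ := by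
  have h1 := norm_sq_proj hp x
  have h2 := pow_le_pow_left₀ (norm_nonneg _) h 2
  rw [mul_pow] at h2
  have h3 : (D ^ 2)⁻¹ * ‖x‖ ^ 2 ≤ ‖p x‖ ^ 2 := by
    rw [inv_mul_le_iff₀ (by positivity)]; exact h2
  have h4 : ‖x - p x‖ ^ 2 ≤ (1 - (D ^ 2)⁻¹) * ‖x‖ ^ 2 := by linarith
  calc ‖x - p x‖ = √(‖x - p x‖ ^ 2) := (Real.sqrt_sq (norm_nonneg _)).symm
    _ ≤ √((1 - (D ^ 2)⁻¹) * ‖x‖ ^ 2) := Real.sqrt_le_sqrt h4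
    _ = √(1 - (D ^ 2)⁻¹) * ‖x‖ := by
      rw [Real.sqrt_mul' _ (sq_nonneg _), Real.sqrt_sq (norm_nonneg x)]

/-- On the range of `Q - [Q P₁ H]` the operator `P₁` vanishes, so a vector there that is killed by
`P - P₁` lies in `ker P ∩ Q H`, the projection onto which has finite trace. -/
lemma trace_sub_rangeProj_lt_top {P Q P₁ : N} (hP : IsStarProjection P) (hQ : IsStarProjection Q)
    (hP₁ : IsStarProjection P₁) (hPP₁ : P * P₁ = P₁) (hτ : τ (P - P₁) < ∞)
    (hker : HasFiniteProj τ (kerOn Q (P * Q))) :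
    IsStarProjection (Q - rangeProj (Q * P₁)) ∧ τ (Q - rangeProj (Q * P₁)) < ∞ := by
  set Q₁ := rangeProj (Q * P₁) with hQ₁def
  have hQ₁ : IsStarProjection Q₁ := isStarProjection_rangeProj _
  have hstar : star (Q * P₁) = P₁ * Q := by rw [star_mul, hQ.2.star_eq, hP₁.2.star_eq]
  have hker₁ : ∀ z : H, (Q₁ : H →L[ℂ] H) z = 0 ↔ (P₁ : H →L[ℂ] H) ((Q : H →L[ℂ] H) z) = 0 := by
    intro z
    rw [hQ₁def, rangeProj_apply_eq_zero_iff, hstar]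
    rfl
  have hQ₁Q : Q₁ * Q = Q₁ := by
    refine Subtype.ext (ContinuousLinearMap.ext fun z => ?_)
    have h := (hker₁ (z - (Q : H →L[ℂ] H) z)).2 (by
      rw [map_sub, proj_apply_self (isStarProjection_coe_iff.2 hQ), sub_self, map_zero])
    rw [map_sub, sub_eq_zero] at h
    exact h.symm
  have hQQ₁ : Q * Q₁ = Q₁ := by
    have := congrArg star hQ₁Q
    rwa [star_mul, hQ.2.star_eq, hQ₁.2.star_eq] at this
  have hn : IsStarProjection (Q - Q₁) := isStarProjection_sub hQ₁ hQ hQQ₁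
  refine ⟨hn, ?_⟩
  obtain ⟨he, hτe⟩ := hker
  set e : N := ⟨closureProj (kerOn Q (P * Q)), he⟩
  have hep : IsStarProjection e := isStarProjection_coe_iff.1 (isStarProjection_closureProj _)
  have hd : IsStarProjection (P - P₁) := isStarProjection_sub hP₁ hP hPP₁
  refine ((IsFiniteRank.of_proj hd hτ).add (IsFiniteRank.of_proj hep hτe)).trace_lt_top hn
    fun z hz h0 => ?_
  obtain ⟨hz1, hz2⟩ := apply_eq_zero_of_proj_add hd hep h0
  have hQz : (Q : H →L[ℂ] H) z = z := by
    have h1 : Q * (Q - Q₁) = Q - Q₁ := by rw [mul_sub, hQ.1.eq, hQQ₁]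
    have h2 : (Q : H →L[ℂ] H) (((Q - Q₁ : N) : H →L[ℂ] H) z) = ((Q - Q₁ : N) : H →L[ℂ] H) z :=
      congrArg (fun T : N => (T : H →L[ℂ] H) z) h1
    rwa [hz] at h2
  have hQ₁z : (Q₁ : H →L[ℂ] H) z = 0 := by
    have : (Q : H →L[ℂ] H) z - (Q₁ : H →L[ℂ] H) z = z := hz
    rwa [hQz, sub_eq_self] at this
  have hP₁z : (P₁ : H →L[ℂ] H) z = 0 := by
    have := (hker₁ z).1 hQ₁z
    rwa [hQz] at this
  have hPz : (P : H →L[ℂ] H) z = 0 := by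
    have : (P : H →L[ℂ] H) z - (P₁ : H →L[ℂ] H) z = 0 := hz1
    rwa [hP₁z, sub_zero] at this
  have hmem : z ∈ kerOn Q (P * Q) := by
    refine ⟨?_, ⟨z, hQz⟩⟩
    change (P : H →L[ℂ] H) ((Q : H →L[ℂ] H) z) = 0
    rw [hQz, hPz]
  rw [← closureProj_apply_of_mem hmem]
  exact hz2

theorem norm_calkinMap_sub_lt_one {P Q : N} (hP : IsStarProjection P) (hQ : IsStarProjection Q)
    (h : IsTauFredholm τ P Q (P * Q)) : ‖calkinMap τ P - calkinMap τ Q‖ < 1 := by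
  obtain ⟨P₁, hP₁, hle, hτ, hrange⟩ := h.exists_proj
  have hPP₁ : P * P₁ = P₁ := (proj_le_iff hP₁ hP).1 hle
  obtain ⟨hn, hτn⟩ := trace_sub_rangeProj_lt_top hP hQ hP₁ hPP₁ hτ h.finite_ker
  have hd : IsStarProjection (P - P₁) := isStarProjection_sub hP₁ hP hPP₁
  have hP' := isStarProjection_coe_iff.2 hP
  have hQ' := isStarProjection_coe_iff.2 hQ
  have hP₁' := isStarProjection_coe_iff.2 hP₁
  set Q₁ := rangeProj (Q * P₁) with hQ₁def
  have hQ₁' : IsStarProjection (Q₁ : H →L[ℂ] H) := isStarProjection_closureProj _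
  obtain ⟨C, hC, hbound⟩ := exists_norm_le_of_range_le hP₁' hrange
  -- `Q` is bounded below on the range of `P₁`; the constant is raised to `C + 1 ≥ 1` so that the
  -- square root in the gap estimate has a nonnegative argument.
  have hbQ : ∀ x : H, (P₁ : H →L[ℂ] H) x = x → ‖x‖ ≤ (C + 1) * ‖(Q : H →L[ℂ] H) x‖ := by
    intro x hx
    have h1 := hbound x hx
    have h2 : (star ((P * Q : N) : H →L[ℂ] H) : H →L[ℂ] H) x = (Q : H →L[ℂ] H) x := by
      change (star ((P : H →L[ℂ] H) * (Q : H →L[ℂ] H)) : H →L[ℂ] H) x = _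
      rw [star_mul, hP'.2.star_eq, hQ'.2.star_eq]
      change (Q : H →L[ℂ] H) ((P : H →L[ℂ] H) x) = _
      congr 1
      rw [← hx]
      exact congrArg (fun T : N => (T : H →L[ℂ] H) x) hPP₁
    rw [h2] at h1
    nlinarith [norm_nonneg ((Q : H →L[ℂ] H) x)]
  have hbQ₁ : ∀ x : H, (P₁ : H →L[ℂ] H) x = x → ‖x‖ ≤ (C + 1) * ‖(Q₁ : H →L[ℂ] H) x‖ := by
    intro x hx
    have h1 : (Q₁ : H →L[ℂ] H) x = (Q : H →L[ℂ] H) x := by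
      have h2 : (Q₁ : H →L[ℂ] H) ((Q : H →L[ℂ] H) x) = (Q : H →L[ℂ] H) x := by
        conv_lhs => rw [← hx]
        conv_rhs => rw [← hx]
        exact congrArg (fun T : N => (T : H →L[ℂ] H) x) (rangeProj_mul_self (Q * P₁))
      have h3 : (Q₁ : H →L[ℂ] H) (x - (Q : H →L[ℂ] H) x) = 0 := by
        rw [hQ₁def, rangeProj_apply_eq_zero_iff, star_mul, hQ.2.star_eq, hP₁.2.star_eq]
        change (P₁ : H →L[ℂ] H) ((Q : H →L[ℂ] H) (x - (Q : H →L[ℂ] H) x)) = 0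
        rw [map_sub, proj_apply_self hQ', sub_self, map_zero]
      rw [map_sub, sub_eq_zero] at h3
      rw [h3, h2]
    rw [h1]
    exact hbQ x hx
  -- By duality `P₁` is bounded below on the range of `Q P₁`, hence on its closure.
  have hbP₁ : ∀ x : H, (Q₁ : H →L[ℂ] H) x = x → ‖x‖ ≤ (C + 1) * ‖(P₁ : H →L[ℂ] H) x‖ := by
    intro x hx
    have hcl : IsClosed {x : H | ‖x‖ ≤ (C + 1) * ‖(P₁ : H →L[ℂ] H) x‖} :=
      isClosed_le continuous_norm (by fun_prop)
    have hxm : x ∈ closure (((Q * P₁ : N) : H →L[ℂ] H).range : Set H) :=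
      Submodule.starProjection_eq_self_iff.1 hx
    refine closure_minimal ?_ hcl hxm
    rintro _ ⟨w, rfl⟩
    set y := (P₁ : H →L[ℂ] H) w with hy
    have hPy : (P₁ : H →L[ℂ] H) y = y := proj_apply_self hP₁' w
    change ‖(Q : H →L[ℂ] H) y‖ ≤ (C + 1) * ‖(P₁ : H →L[ℂ] H) ((Q : H →L[ℂ] H) y)‖
    have h1 : ‖(Q : H →L[ℂ] H) y‖ ^ 2 ≤ ‖(P₁ : H →L[ℂ] H) ((Q : H →L[ℂ] H) y)‖ * ‖y‖ := by
      calc ‖(Q : H →L[ℂ] H) y‖ ^ 2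
          = RCLike.re (inner ℂ ((P₁ : H →L[ℂ] H) ((Q : H →L[ℂ] H) y)) y) := by
            rw [inner_proj hP₁', hPy, ← proj_apply_self hQ', inner_proj hQ', proj_apply_self hQ',
              inner_self_eq_norm_sq]
        _ ≤ _ := re_inner_le_norm _ _
    have h2 := hbQ y hPy
    rcases (norm_nonneg ((Q : H →L[ℂ] H) y)).eq_or_lt with h0 | h0
    · rw [← h0]; positivity
    · have h3 := mul_le_mul_of_nonneg_left h2
        (norm_nonneg ((P₁ : H →L[ℂ] H) ((Q : H →L[ℂ] H) y)))
      refine le_of_mul_le_mul_right ?_ h0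
      linarith
  have hgap : ‖P₁ - Q₁‖ ≤ √(1 - ((C + 1) ^ 2)⁻¹) :=
    norm_sub_le_of_gap hP₁' hQ₁' (Real.sqrt_nonneg _)
      (fun x hx => norm_sub_proj_le hP₁' (by positivity) (hbP₁ x hx))
      (fun x hx => norm_sub_proj_le hQ₁' (by positivity) (hbQ₁ x hx))
  rw [calkinMap_eq_of_sub_mem (mem_compactIdeal_of_proj hd hτ),
    calkinMap_eq_of_sub_mem (mem_compactIdeal_of_proj hn hτn), ← map_sub]
  refine ((norm_calkinMap_le _).trans hgap).trans_lt ?_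
  rw [Real.sqrt_lt' one_pos, one_pow, sub_lt_self_iff]
  positivity

/-! ### From the norm estimate to the Fredholm property -/

lemma mem_kerOn_iff {Q T : N} (hQ : IsStarProjection Q) {z : H} :
    z ∈ kerOn Q T ↔ (T : H →L[ℂ] H) z = 0 ∧ (Q : H →L[ℂ] H) z = z :=
  and_congr Iff.rfl (mem_range_proj_iff (isStarProjection_coe_iff.2 hQ))

lemma isClosed_kerOn {Q T : N} (hQ : IsStarProjection Q) : IsClosed (kerOn Q T : Set H) :=
  (isClosed_ker (T : H →L[ℂ] H)).inter
    (IsIdempotentElem.isClosed_range (isStarProjection_coe_iff.2 hQ).1)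

lemma kerOn_invariant {Q T : N} (hQ : IsStarProjection Q) :
    ∀ y ∈ N.commutant, ∀ z ∈ kerOn Q T, y z ∈ kerOn Q T := by
  intro y hy z hz
  rw [mem_kerOn_iff hQ] at hz ⊢
  rw [← commute_apply hy, ← commute_apply hy, hz.1, hz.2, map_zero]
  exact ⟨rfl, rfl⟩

lemma closureProj_map_mem {K : Submodule ℂ H} (hK : ∀ y ∈ N.commutant, ∀ z ∈ K, y z ∈ K) (T : N) :
    closureProj (K.map ((T : H →L[ℂ] H) : H →ₗ[ℂ] H)) ∈ N := by
  refine closureProj_mem ?_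
  rintro y hy _ ⟨z, hz, rfl⟩
  exact ⟨y z, hK y hy z hz, (commute_apply hy T z).symm⟩

lemma isClosed_map_of_bounded_below {K : Submodule ℂ H} (hK : IsClosed (K : Set H))
    {T : H →L[ℂ] H} {C : ℝ} (hC : 0 ≤ C) (h : ∀ x ∈ K, ‖x‖ ≤ C * ‖T x‖) :
    IsClosed (K.map (T : H →ₗ[ℂ] H) : Set H) := by
  have : CompleteSpace K := hK.completeSpace_coe
  have h1 : AntilipschitzWith ⟨C, hC⟩ (T ∘L K.subtypeL) :=
    (T ∘L K.subtypeL).antilipschitz_of_bound fun x => h x x.2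
  have h2 := h1.isClosed_range (T ∘L K.subtypeL).uniformContinuous
  convert h2 using 1
  ext z
  simp

/-- The projection onto `P Q (P H ∩ ker k)`, a closed subspace because `P Q` is bounded below on
`P H ∩ ker k`. -/
lemma exists_proj_of_norm_sub_lt {P Q k : N} (hP : IsStarProjection P) (hQ : IsStarProjection Q)
    (hk : IsFiniteRank τ k) (hlt : ‖P - Q - k‖ < 1) :
    ∃ P₁ : N, IsStarProjection P₁ ∧ P₁ ≤ P ∧ τ (P - P₁) < ∞ ∧
      (P₁ : H →L[ℂ] H).range ≤ ((P * Q : N) : H →L[ℂ] H).range := by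
  have hP' := isStarProjection_coe_iff.2 hP
  have hQ' := isStarProjection_coe_iff.2 hQ
  set c := ‖P - Q - k‖ with hc
  have hc0 : 0 ≤ c := norm_nonneg _
  have hc1 : 0 < 1 - c ^ 2 := by nlinarith
  set K₁ := kerOn P k with hK₁
  have hK₁cl : IsClosed (K₁ : Set H) := isClosed_kerOn hP
  -- `P Q` is bounded below where `P` is the identity and `k` vanishes.
  have hbelow : ∀ x ∈ K₁, ‖x‖ ≤ (1 - c ^ 2)⁻¹ * ‖((P * Q : N) : H →L[ℂ] H) x‖ := by
    intro x hx
    obtain ⟨hkx, hPx⟩ := (mem_kerOn_iff hP).1 hx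
    have h1 : ‖x - (Q : H →L[ℂ] H) x‖ ≤ c * ‖x‖ := by
      have h2 := ((P - Q - k : N) : H →L[ℂ] H).le_opNorm x
      have h3 : ((P - Q - k : N) : H →L[ℂ] H) x = x - (Q : H →L[ℂ] H) x := by
        change (P : H →L[ℂ] H) x - (Q : H →L[ℂ] H) x - (k : H →L[ℂ] H) x = _
        rw [hkx, hPx, sub_zero]
      rwa [h3] at h2
    have h4 := norm_sq_proj hQ' x
    have h5 := pow_le_pow_left₀ (norm_nonneg _) h1 2
    have h6 : ‖(Q : H →L[ℂ] H) x‖ ^ 2 ≤ ‖((P * Q : N) : H →L[ℂ] H) x‖ * ‖x‖ := by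
      calc ‖(Q : H →L[ℂ] H) x‖ ^ 2
          = RCLike.re (inner ℂ ((P : H →L[ℂ] H) ((Q : H →L[ℂ] H) x)) x) := by
            rw [inner_proj hP', hPx, ← proj_apply_self hQ', inner_proj hQ', proj_apply_self hQ',
              inner_self_eq_norm_sq]
        _ ≤ _ := re_inner_le_norm _ _
    rw [mul_pow] at h5
    rw [le_inv_mul_iff₀ hc1]
    rcases (norm_nonneg x).eq_or_lt with h0 | h0
    · rw [← h0, mul_zero]; exact norm_nonneg _
    · exact le_of_mul_le_mul_right (by nlinarith) h0
  set T : H →L[ℂ] H := ((P * Q : N) : H →L[ℂ] H) with hT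
  set K₂ := K₁.map (T : H →ₗ[ℂ] H) with hK₂
  have hK₂cl : IsClosed (K₂ : Set H) :=
    isClosed_map_of_bounded_below hK₁cl (inv_nonneg.2 hc1.le) hbelow
  let p₁ : N := ⟨closureProj K₁, closureProj_mem (kerOn_invariant hP)⟩
  let p₂ : N := ⟨closureProj K₂, closureProj_map_mem (kerOn_invariant hP) (P * Q)⟩
  have hp₁ : IsStarProjection p₁ := isStarProjection_coe_iff.1 (isStarProjection_closureProj _)
  have hp₂ : IsStarProjection p₂ := isStarProjection_coe_iff.1 (isStarProjection_closureProj _)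
  have hmem : ∀ {K : Submodule ℂ H}, IsClosed (K : Set H) → ∀ z, closureProj K z ∈ K :=
    fun hK z => mem_of_closureProj_apply hK (proj_apply_self (isStarProjection_closureProj _) z)
  have hPp₁ : P * p₁ = p₁ := by
    refine Subtype.ext (ContinuousLinearMap.ext fun z => ?_)
    exact ((mem_kerOn_iff hP).1 (hmem hK₁cl z)).2
  have hPp₂ : P * p₂ = p₂ := by
    refine Subtype.ext (ContinuousLinearMap.ext fun z => ?_)
    obtain ⟨w, -, hw⟩ := hmem hK₂cl z
    change (P : H →L[ℂ] H) (closureProj K₂ z) = closureProj K₂ z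
    rw [← hw]
    exact proj_apply_self hP' _
  have hg : IsStarProjection (P - p₁) := isStarProjection_sub hp₁ hP hPp₁
  have he : IsStarProjection (P - p₂) := isStarProjection_sub hp₂ hP hPp₂
  -- A vector in the range of `P - p` is fixed by `P` and killed by `p`.
  have hsplit : ∀ {p : N}, P * p = p → ∀ z : H, ((P - p : N) : H →L[ℂ] H) z = z →
      (P : H →L[ℂ] H) z = z ∧ (p : H →L[ℂ] H) z = 0 := by
    intro p hp z hz
    have h1 : P * (P - p) = P - p := by rw [mul_sub, hP.1.eq, hp]
    have h2 : (P : H →L[ℂ] H) (((P - p : N) : H →L[ℂ] H) z) = ((P - p : N) : H →L[ℂ] H) z :=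
      congrArg (fun T : N => (T : H →L[ℂ] H) z) h1
    rw [hz] at h2
    have h3 : (P : H →L[ℂ] H) z - (p : H →L[ℂ] H) z = z := hz
    rw [h2, sub_eq_self] at h3
    exact ⟨h2, h3⟩
  have hgτ : τ (P - p₁) < ∞ := hk.trace_lt_top hg fun z hz hkz => by
    obtain ⟨hPz, hpz⟩ := hsplit hPp₁ z hz
    have h1 : z ∈ K₁ := (mem_kerOn_iff hP).2 ⟨hkz, hPz⟩
    rw [← closureProj_apply_of_mem h1]
    exact hpz
  have hgr : IsFiniteRank τ (P - p₁) := .of_proj hg hgτ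
  -- The element `k⋆k + w⋆w` of finite rank is injective on the range of `P - p₂`: where `k` and `w`
  -- vanish, `P Q z` lies in `P H ∩ ker k`, and `z ⊥ P Q (P Q z)` forces `P Q z = 0`.
  refine ⟨p₂, hp₂, (proj_le_iff hp₂ hP).2 hPp₂, ?_, ?_⟩
  · set w : N := (P - p₁) * (P * Q) with hw
    refine ((hk.mul_left (star k)).add ((hgr.mul_right (P * Q)).mul_left (star w))).trace_lt_top he
      fun z hz h0 => ?_
    obtain ⟨hPz, hpz⟩ := hsplit hPp₂ z hz
    obtain ⟨hkz, hwz⟩ := apply_eq_zero_of_star_mul_add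
      (x := (k : H →L[ℂ] H)) (y := (w : H →L[ℂ] H)) h0
    have hTP : (P : H →L[ℂ] H) (T z) = T z := proj_apply_self hP' _
    have hp₁T : closureProj K₁ (T z) = T z := by
      have h1 : (P : H →L[ℂ] H) (T z) - closureProj K₁ (T z) = 0 := hwz
      rw [hTP, sub_eq_zero] at h1
      exact h1.symm
    have hmemT : T (T z) ∈ K₂ := ⟨T z, mem_of_closureProj_apply hK₁cl hp₁T, rfl⟩
    have horth : inner ℂ (T (T z)) z = 0 := closureProj_apply_eq_zero_iff.1 hpz _ hmemT
    have hinner : inner ℂ (T (T z)) z = inner ℂ (T z) (T z) := by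
      change inner ℂ ((P : H →L[ℂ] H) ((Q : H →L[ℂ] H) (T z))) z =
        inner ℂ (T z) ((P : H →L[ℂ] H) ((Q : H →L[ℂ] H) z))
      rw [inner_proj hP', hPz, inner_proj hQ', ← inner_proj hP', hTP]
    have hTz : T z = 0 := inner_self_eq_zero.1 (hinner.symm.trans horth)
    have h2 := hbelow z ((mem_kerOn_iff hP).2 ⟨hkz, hPz⟩)
    rw [hTz, norm_zero, mul_zero] at h2
    exact norm_le_zero_iff.1 h2
  · rintro _ ⟨z, rfl⟩
    obtain ⟨u, -, hu⟩ := hmem hK₂cl z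
    exact ⟨u, hu⟩

theorem isTauFredholm_of_norm_sub_lt {P Q k : N} (hP : IsStarProjection P)
    (hQ : IsStarProjection Q) (hk : IsFiniteRank τ k) (hlt : ‖P - Q - k‖ < 1) :
    IsTauFredholm τ P Q (P * Q) := by
  have hinj : ∀ z : H, (k : H →L[ℂ] H) z = 0 →
      ‖(P : H →L[ℂ] H) z - (Q : H →L[ℂ] H) z‖ = ‖z‖ → z = 0 := by
    intro z hkz hz
    have h2 := ((P - Q - k : N) : H →L[ℂ] H).le_opNorm z
    have h3 : ((P - Q - k : N) : H →L[ℂ] H) z = (P : H →L[ℂ] H) z - (Q : H →L[ℂ] H) z := by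
      change (P : H →L[ℂ] H) z - (Q : H →L[ℂ] H) z - (k : H →L[ℂ] H) z = _
      rw [hkz, sub_zero]
    rw [h3, hz] at h2
    have h4 : ‖((P - Q - k : N) : H →L[ℂ] H)‖ < 1 := hlt
    by_contra hne
    have h5 := norm_pos_iff.2 hne
    nlinarith
  refine ⟨⟨1, by rw [mul_one]⟩, ?_, ?_, exists_proj_of_norm_sub_lt hP hQ hk hlt⟩
  · refine hasFiniteProj_of_injective (isClosed_kerOn hQ) (kerOn_invariant hQ) hk
      fun z hz hkz => hinj z hkz ?_
    obtain ⟨h1, h2⟩ := (mem_kerOn_iff hQ).1 hz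
    have h3 : (P : H →L[ℂ] H) ((Q : H →L[ℂ] H) z) = 0 := h1
    rw [h2] at h3
    rw [h3, h2, zero_sub, norm_neg]
  · refine hasFiniteProj_of_injective (isClosed_kerOn hP) (kerOn_invariant hP) hk
      fun z hz hkz => hinj z hkz ?_
    rw [star_mul, hP.2.star_eq, hQ.2.star_eq] at hz
    obtain ⟨h1, h2⟩ := (mem_kerOn_iff hP).1 hz
    have h3 : (Q : H →L[ℂ] H) ((P : H →L[ℂ] H) z) = 0 := h1
    rw [h2] at h3
    rw [h3, h2, sub_zero]

end BreuerFredholm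

theorem lemma4p1 {H : Type*} [NormedAddCommGroup H] [InnerProductSpace ℂ H] [CompleteSpace H]
    (N : VonNeumannAlgebra H) (τ : BreuerFredholm.FaithfulNormalSemifiniteTrace N)
    (P Q : N) (hP : IsStarProjection P) (hQ : IsStarProjection Q) :
    BreuerFredholm.IsTauFredholm τ P Q (P * Q) ↔
      ‖BreuerFredholm.calkinMap τ P - BreuerFredholm.calkinMap τ Q‖ < 1 := by
  refine ⟨BreuerFredholm.norm_calkinMap_sub_lt_one hP hQ, fun h => ?_⟩
  rw [← map_sub] at h
  obtain ⟨k, hk, hlt⟩ := BreuerFredholm.exists_isFiniteRank_norm_sub_lt h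
  exact BreuerFredholm.isTauFredholm_of_norm_sub_lt hP hQ hk hlt
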